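/- Let $\varphi:\mathbb{R}^n\to\mathbb{R}\cup\{\infty\}$ be lower semicontinuous. For a point $x$ with $\varphi(x)<\infty$ let $\widehat\partial\varphi(x)$ be the set of all $x^*$ with $\liminf_{y\to x,\,y\neq x}\frac{\varphi(y)-\varphi(x)-\langle x^*,y-x\rangle}{\|y-x\|}\ge 0$. Let $\partial\varphi(x)$ be the limiting subdifferential, i.e. the set of all $x^*$ for which there are $x_k\to x$ and $x_k^*\to x^*$ with $x_k^*\in\widehat\partial\varphi(x_k)$ for all $k$ and $\varphi(x_k)\to\varphi(x)$. At points where $\varphi=\infty$ both sets are empty. Let $x^*\in\partial\varphi(x)$. Then $\varphi$ is prox-regular at $x$ for $x^*$ if there are $\epsilon>0$ and $\rho\ge 0$ such that $\varphi(y')\ge\varphi(y)+\langle y^*,y'-y\rangle-\frac\rho2\|y'-y\|^2$ for all $y',y$ in the closed ball of radius $\epsilon$ around $x$ with $|\varphi(y)-\varphi(x)|\le\epsilon$ and all $y^*\in\partial\varphi(y)$ with $\|y^*-x^*\|\le\epsilon$. It is subdifferentially continuous at $x$ for $x^*$ if $\varphi(x_k)\to\varphi(x)$ for every sequence $(x_k,x_k^*)\to(x,x^*)$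 in $\operatorname{gph}\partial\varphi$. Let $\operatorname{proxreg}\varphi$ be the set of all $(x,x^*)\in\operatorname{gph}\partial\varphi$ such that $\varphi$ is prox-regular and subdifferentially continuous at $x$ for $x^*$. Let $\mathcal{Z}_n$ be the set of $n$-dimensional subspaces of $\mathbb{R}^{2n}$ with the metric $d(L_1,L_2)=\|P_{L_1}-P_{L_2}\|$ (spectral norm of the difference of the orthogonal projections), and for $L\in\mathcal{Z}_n$ let $L^*=\{(-v^*,u^*) : (u^*,v^*)\in L^\perp\}$. For a set-valued mapping $F:\mathbb{R}^n\rightrightarrows\mathbb{R}^n$ let $\mathcal{O}_F$ be the set of all $(x,y)\in\operatorname{gph}F$ at which the (Bouligand) tangent cone $T_{\operatorname{gph}F}(x,y)$ belongs to $\mathcal{Z}_n$. For $(x,y)\in\operatorname{gph}F$ let $$\mathcal{S}F(x,y)=\{L\in\mathcal{Z}_n : \exists\,(x_k,y_k)\in\mathcal{O}_F,\ (x_k,y_k)\to(x,y),\ d(L,T_{\operatorname{gph}F}(x_k,y_k))\to 0\},\qquad \mathcal{S}^*F(x,y)=\{L^* : L\in\mathcal{S}F(x,y)\}.$$ Finally,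 let $\mathcal{Z}_n^{P,W}$ be the set of all $L\in\mathcal{Z}_n$ of the form $L=\operatorname{rge}(P,W):=\{(Pu,Wu) : u\in\mathbb{R}^n\}$ with symmetric $n\times n$ matrices $P,W$ satisfying $P^2=P$ and $W(I-P)=I-P$. Assume that $\operatorname{proxreg}\varphi$ is dense in $\operatorname{gph}\partial\varphi$. Then for every $(x,x^*)\in\operatorname{proxreg}\varphi$, $$\emptyset\neq\mathcal{S}\partial\varphi(x,x^*)\subset\mathcal{Z}_n^{P,W},$$ and for every $(x,x^*)\in\operatorname{gph}\partial\varphi$, $$\mathcal{S}\partial\varphi(x,x^*)\cap\mathcal{Z}_n^{P,W}=\mathcal{S}^*\partial\varphi(x,x^*)\cap\mathcal{Z}_n^{P,W}\neq\emptyset.$$ -/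

import Mathlib

open Filter Topology

namespace SCD

/-- `ℝⁿ` with the Euclidean norm. -/
abbrev Rn (n : ℕ) : Type := EuclideanSpace ℝ (Fin n)

/-- `ℝ²ⁿ = ℝⁿ × ℝⁿ` with the Euclidean norm. -/
abbrev R2n (n : ℕ) : Type := WithLp 2 (Rn n × Rn n)

/-- The pair `(u, v)` as an element of `ℝ²ⁿ`. -/
abbrev pair {n : ℕ} (u v : Rn n) : R2n n := WithLp.toLp 2 (u, v)

variable {n : ℕ}

theorem pair_add (u₁ u₂ v₁ v₂ : Rn n) :
    pair (u₁ + u₂) (v₁ + v₂) = pair u₁ v₁ + pair u₂ v₂ := rfl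

theorem pair_zero : pair (0 : Rn n) 0 = 0 := rfl

theorem pair_smul (c : ℝ) (u v : Rn n) : pair (c • u) (c • v) = c • pair u v := rfl

/-! ### Subdifferentials, prox-regularity, subdifferential continuity

Functions `q : ℝⁿ → ℝ ∪ {∞}` are modelled as `q : Rn n → EReal` that never take the value `⊥`. -/

/-- The regular (Fréchet) subdifferential at points of `dom q`; it is empty outside `dom q`. -/
def regularSubdiff (q : Rn n → EReal) (xb : Rn n) : Set (Rn n) :=
  {xs | q xb < ⊤ ∧
    0 ≤ liminf (fun x => (q x - q xb - ((inner ℝ xs (x - xb) : ℝ) : EReal)) /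
      ((‖x - xb‖ : ℝ) : EReal)) (𝓝[≠] xb)}

/-- The limiting (Mordukhovich) subdifferential. -/
def subdiff (q : Rn n → EReal) (xb : Rn n) : Set (Rn n) :=
  {xs | q xb < ⊤ ∧ ∃ (x : ℕ → Rn n) (v : ℕ → Rn n),
    Tendsto x atTop (𝓝 xb) ∧ Tendsto v atTop (𝓝 xs) ∧
    (∀ k, v k ∈ regularSubdiff q (x k)) ∧ Tendsto (fun k => q (x k)) atTop (𝓝 (q xb))}

/-- The graph of a set-valued mapping `F : ℝⁿ ⇉ ℝⁿ`, as a subset of `ℝ²ⁿ`. -/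
def gph (F : Rn n → Set (Rn n)) : Set (R2n n) := {z | z.snd ∈ F z.fst}

/-- `q` is prox-regular at `xb` for `xbs ∈ ∂q(xb)`. The two inequalities between `q x` and `q xb`
say that `|q x - q xb| ≤ ε`. -/
def IsProxRegularAt (q : Rn n → EReal) (xb xbs : Rn n) : Prop :=
  xbs ∈ subdiff q xb ∧ ∃ ε > (0 : ℝ), ∃ ρ ≥ (0 : ℝ),
    ∀ x' ∈ Metric.closedBall xb ε, ∀ x ∈ Metric.closedBall xb ε,
      q x ≤ q xb + (ε : EReal) → q xb ≤ q x + (ε : EReal) →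
      ∀ xs ∈ subdiff q x ∩ Metric.closedBall xbs ε,
        q x + ((inner ℝ xs (x' - x) - ρ / 2 * ‖x' - x‖ ^ 2 : ℝ) : EReal) ≤ q x'

/-- `q` is subdifferentially continuous at `xb` for `xbs ∈ ∂q(xb)`. -/
def IsSubdiffContinuousAt (q : Rn n → EReal) (xb xbs : Rn n) : Prop :=
  xbs ∈ subdiff q xb ∧ ∀ (x : ℕ → Rn n) (xs : ℕ → Rn n),
    (∀ k, xs k ∈ subdiff q (x k)) → Tendsto x atTop (𝓝 xb) → Tendsto xs atTop (𝓝 xbs) →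
    Tendsto (fun k => q (x k)) atTop (𝓝 (q xb))

/-- The set of all `(x, x*) ∈ gph ∂φ` such that `φ` is prox-regular and subdifferentially
continuous at `x` for `x*`. -/
def proxreg (φ : Rn n → EReal) : Set (R2n n) :=
  {z | z ∈ gph (subdiff φ) ∧ IsProxRegularAt φ z.fst z.snd ∧
    IsSubdiffContinuousAt φ z.fst z.snd}

/-! ### The metric space of `n`-dimensional subspaces of `ℝ²ⁿ` -/

/-- The collection of all `n`-dimensional subspaces of `ℝ²ⁿ`. -/
def Z (n : ℕ) : Set (Submodule ℝ (R2n n)) := {L | Module.finrank ℝ L = n}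

/-- The distance of two subspaces: operator norm of the difference of the orthogonal
projections. -/
noncomputable def dZ (L₁ L₂ : Submodule ℝ (R2n n)) : ℝ :=
  ‖L₁.starProjection - L₂.starProjection‖

/-- The adjoint subspace `L* = {(-v*, u*) | (u*, v*) ∈ Lᗮ}`. -/
def adjointSubspace (L : Submodule ℝ (R2n n)) : Submodule ℝ (R2n n) where
  carrier := {z | ∃ us vs : Rn n, pair us vs ∈ Lᗮ ∧ z = pair (-vs) us}
  add_mem' := by
    rintro _ _ ⟨u₁, v₁, h₁, rfl⟩ ⟨u₂, v₂, h₂, rfl⟩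
    refine ⟨u₁ + u₂, v₁ + v₂, ?_, ?_⟩
    · rw [pair_add]
      exact Lᗮ.add_mem h₁ h₂
    · rw [neg_add, pair_add]
  zero_mem' := by
    refine ⟨0, 0, ?_, ?_⟩
    · rw [pair_zero]
      exact Lᗮ.zero_mem
    · rw [neg_zero, pair_zero]
  smul_mem' := by
    rintro c _ ⟨u, v, h, rfl⟩
    refine ⟨c • u, c • v, ?_, ?_⟩
    · rw [pair_smul]
      exact Lᗮ.smul_mem c h
    · rw [← smul_neg, pair_smul]

/-! ### The SC derivative

Mathlib's `posTangentConeAt A x` is, at points `x ∈ A`, the tangent (Bouligand, contingent) cone: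
the outer limit of `(A - x) / t` as `t ↓ 0`. -/

theorem mem_posTangentConeAt_iff_seq {A : Set (R2n n)} {x : R2n n} (hx : x ∈ A) (u : R2n n) :
    u ∈ posTangentConeAt A x ↔ ∃ (t : ℕ → ℝ) (w : ℕ → R2n n), (∀ k, 0 < t k) ∧
      Tendsto t atTop (𝓝 0) ∧ Tendsto w atTop (𝓝 u) ∧ ∀ k, x + t k • w k ∈ A := by
  constructor
  · intro h
    rcases eq_or_ne u 0 with rfl | hu
    · exact ⟨fun k => 1 / ((k : ℝ) + 1), fun _ => 0, fun k => by positivity,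
        tendsto_one_div_add_atTop_nhds_zero_nat, tendsto_const_nhds, fun k => by simpa using hx⟩
    · obtain ⟨c, d, hd, hs, hcd⟩ := mem_tangentConeAt_iff_exists_seq.1 h
      have hne : ∀ᶠ k in atTop, c k • d k ≠ 0 := hcd.eventually_ne hu
      obtain ⟨N, hN⟩ := eventually_atTop.1 (hs.and hne)
      have ht : Tendsto (fun k => ‖d k‖ / ‖c k • d k‖) atTop (𝓝 0) := by
        have h := hd.norm.div hcd.norm (norm_ne_zero_iff.2 hu)
        rw [norm_zero, zero_div] at h
        exact h
      refine ⟨fun k => ‖d (k + N)‖ / ‖c (k + N) • d (k + N)‖, fun k => c (k + N) • d (k + N),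
        fun k => ?_, (tendsto_add_atTop_iff_nat N).2 ht, (tendsto_add_atTop_iff_nat N).2 hcd,
        fun k => ?_⟩
      · have h0 := (hN (k + N) (by omega)).2
        exact div_pos (norm_pos_iff.2 (right_ne_zero_of_smul h0)) (norm_pos_iff.2 h0)
      · obtain ⟨h1, h0⟩ := hN (k + N) (by omega)
        have hc : (c (k + N) : ℝ) ≠ 0 := by
          exact_mod_cast left_ne_zero_of_smul h0
        have hdn : ‖d (k + N)‖ ≠ 0 := norm_ne_zero_iff.2 (right_ne_zero_of_smul h0)
        have e : (‖d (k + N)‖ / ‖c (k + N) • d (k + N)‖) • c (k + N) • d (k + N)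
            = d (k + N) := by
          have hn : ‖(c (k + N) : ℝ)‖ = c (k + N) := Real.norm_of_nonneg (c (k + N)).2
          rw [NNReal.smul_def, norm_smul, smul_smul, hn]
          rw [div_mul_eq_mul_div, mul_comm (‖d (k + N)‖), div_self (mul_ne_zero hc hdn), one_smul]
        simpa only [e] using h1
  · rintro ⟨t, w, ht, ht0, hw, hA⟩
    refine mem_tangentConeAt_of_seq atTop (fun k => (t k)⁻¹.toNNReal)
      (fun k => t k • w k) (by simpa using ht0.smul hw) (Eventually.of_forall hA) ?_
    refine hw.congr fun k => ?_
    rw [NNReal.smul_def, Real.coe_toNNReal _ (inv_pos.2 (ht k)).le, smul_smul,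
      inv_mul_cancel₀ (ht k).ne', one_smul]

/-- `F` is graphically smooth of dimension `n` at `z ∈ gph F`: the tangent cone to `gph F` at `z`
is an `n`-dimensional subspace. -/
def IsGraphicallySmoothAt (F : Rn n → Set (Rn n)) (z : R2n n) : Prop :=
  z ∈ gph F ∧ ∃ L ∈ Z n, (L : Set (R2n n)) = posTangentConeAt (gph F) z

/-- The set of all points of `gph F` where `F` is graphically smooth of dimension `n`. -/
def smoothPoints (F : Rn n → Set (Rn n)) : Set (R2n n) := {z | IsGraphicallySmoothAt F z}

/-- The SC (subspace containing) derivative of `F` at `z ∈ gph F`: all limits in `Z n` of tangent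
spaces `T k` to `gph F` at smooth points `zs k` converging to `z`. -/
def SCDeriv (F : Rn n → Set (Rn n)) (z : R2n n) : Set (Submodule ℝ (R2n n)) :=
  {L | L ∈ Z n ∧ ∃ (zs : ℕ → R2n n) (T : ℕ → Submodule ℝ (R2n n)),
    (∀ k, zs k ∈ smoothPoints F) ∧ Tendsto zs atTop (𝓝 z) ∧
    (∀ k, (T k : Set (R2n n)) = posTangentConeAt (gph F) (zs k)) ∧
    Tendsto (fun k => dZ L (T k)) atTop (𝓝 0)}

/-- The adjoint SC derivative. -/
def adjointSCDeriv (F : Rn n → Set (Rn n)) (z : R2n n) : Set (Submodule ℝ (R2n n)) :=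
  {M | ∃ L ∈ SCDeriv F z, M = adjointSubspace L}

/-! ### Subspaces of the form `rge (P, W)` -/

/-- `rge (A, B) = {(A u, B u) | u ∈ ℝⁿ}`. -/
def rge (A B : Matrix (Fin n) (Fin n) ℝ) : Set (R2n n) :=
  Set.range fun u : Rn n => pair (Matrix.toEuclideanLin A u) (Matrix.toEuclideanLin B u)

/-- The collection of all `n`-dimensional subspaces `rge (P, W)` with `P`, `W` symmetric,
`P² = P` and `W (I - P) = I - P`. -/
def ZPW (n : ℕ) : Set (Submodule ℝ (R2n n)) :=
  {L | L ∈ Z n ∧ ∃ P W : Matrix (Fin n) (Fin n) ℝ, P.IsSymm ∧ W.IsSymm ∧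
    (L : Set (R2n n)) = rge P W ∧ P ^ 2 = P ∧ W * (1 - P) = 1 - P}

/-- The elements of the SC derivative that have the form `rge (P, W)`. -/
def SCDerivPW (F : Rn n → Set (Rn n)) (z : R2n n) : Set (Submodule ℝ (R2n n)) :=
  SCDeriv F z ∩ ZPW n

/-- The elements of the adjoint SC derivative that have the form `rge (P, W)`. -/
def adjointSCDerivPW (F : Rn n → Set (Rn n)) (z : R2n n) : Set (Submodule ℝ (R2n n)) :=
  adjointSCDeriv F z ∩ ZPW n

end SCD

/-! `ZPW n` is the set of Lagrangian subspaces: an `n`-dimensional `L` has the form `rge (P, W)`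
exactly when the symplectic form vanishes on it (`IsIsotropic.mem_ZPW`, `isIsotropic_of_mem_ZPW`).
Since `L*` is the symplectic complement, Lagrangian means `L* = L`, which gives the equality of the
two derivatives inside `ZPW n`.

Prox-regularity and subdifferential continuity at `z` supply a Minty parametrization
(`exists_isLocalParam`): near `z` the graph of the subdifferential is `{(p s, s - r p s)}` with `p`
Lipschitz, a localized proximal mapping and the gradient of a localized conjugate function. The
tangent cone at such a point is an `n`-dimensional subspace exactly when `p` is differentiable
there. The derivative is then a Hessian, hence symmetric, and the tangent space is Lagrangian. By
Rademacher's theorem such points accumulate at `z`.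

`n`-dimensional subspaces form a compact set and isotropy survives limits, so Lagrangian limits
exist at `z`. Density of `proxreg φ` carries this existence to the whole graph. At points of
`proxreg φ` all nearby smooth points are Lagrangian, hence so is every limit. -/

namespace SCD

variable {n : ℕ}

/-! ### Lagrangian subspaces -/

/-- A subspace of `ℝ²ⁿ` on which the standard symplectic form vanishes. -/
def IsIsotropic (L : Submodule ℝ (R2n n)) : Prop :=
  ∀ a ∈ L, ∀ b ∈ L, inner ℝ a.fst b.snd = inner ℝ a.snd b.fst

theorem pair_eta (z : R2n n) : pair z.fst z.snd = z := rfl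

theorem finrank_R2n : Module.finrank ℝ (R2n n) = n + n := by
  rw [(WithLp.linearEquiv 2 ℝ (Rn n × Rn n)).finrank_eq, Module.finrank_prod]
  simp

/-- The adjoint is the complement of `L` for the symplectic form: the quarter turn converts the
inner product into that form. -/
theorem mem_adjointSubspace_iff {L : Submodule ℝ (R2n n)} {z : R2n n} :
    z ∈ adjointSubspace L ↔ ∀ b ∈ L, inner ℝ b.fst z.snd = inner ℝ b.snd z.fst := by
  have key : z ∈ adjointSubspace L ↔ pair z.snd (-z.fst) ∈ Lᗮ := by
    constructor
    · rintro ⟨u, v, h, rfl⟩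
      simpa using h
    · intro h
      refine ⟨z.snd, -z.fst, h, ?_⟩
      rw [neg_neg, pair_eta]
  rw [key, Submodule.mem_orthogonal]
  refine forall₂_congr fun b _ => ?_
  rw [WithLp.prod_inner_apply, inner_neg_right, ← sub_eq_add_neg, sub_eq_zero]
  rfl

theorem isIsotropic_iff_le_adjointSubspace {L : Submodule ℝ (R2n n)} :
    IsIsotropic L ↔ L ≤ adjointSubspace L := by
  constructor
  · intro h a ha
    exact mem_adjointSubspace_iff.2 fun b hb => h b hb a ha
  · intro h a ha b hb
    exact mem_adjointSubspace_iff.1 (h hb) a ha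

/-- The rotation `(u, v) ↦ (-v, u)` of `ℝ²ⁿ`. -/
def quarterTurn (n : ℕ) : R2n n ≃ₗ[ℝ] R2n n where
  toFun z := pair (-z.snd) z.fst
  invFun z := pair z.snd (-z.fst)
  map_add' a b := by
    rw [← pair_add]
    congr 1
    exact neg_add _ _
  map_smul' c a := by
    change pair (-(c • a.snd)) (c • a.fst) = c • pair (-a.snd) a.fst
    rw [← pair_smul, smul_neg]
  left_inv a := by
    change pair a.fst (- -a.snd) = a
    rw [neg_neg, pair_eta]
  right_inv a := by
    change pair (- -a.fst) a.snd = a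
    rw [neg_neg, pair_eta]

theorem adjointSubspace_eq_map (L : Submodule ℝ (R2n n)) :
    adjointSubspace L = Lᗮ.map (quarterTurn n).toLinearMap := by
  ext z
  constructor
  · rintro ⟨u, v, h, rfl⟩
    exact ⟨pair u v, h, rfl⟩
  · rintro ⟨w, h, rfl⟩
    exact ⟨w.fst, w.snd, h, rfl⟩

theorem finrank_adjointSubspace {L : Submodule ℝ (R2n n)} (hL : L ∈ Z n) :
    Module.finrank ℝ (adjointSubspace L) = n := by
  rw [adjointSubspace_eq_map, LinearEquiv.finrank_map_eq]
  have h := L.finrank_add_finrank_orthogonal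
  have hL' : Module.finrank ℝ L = n := hL
  rw [finrank_R2n, hL'] at h
  omega

theorem IsIsotropic.adjointSubspace_eq {L : Submodule ℝ (R2n n)} (h : IsIsotropic L)
    (hL : L ∈ Z n) : adjointSubspace L = L := by
  refine (Submodule.eq_of_le_of_finrank_eq (isIsotropic_iff_le_adjointSubspace.1 h) ?_).symm
  rw [finrank_adjointSubspace hL]
  exact hL

theorem adjointSubspace_adjointSubspace {L : Submodule ℝ (R2n n)} (hL : L ∈ Z n) :
    adjointSubspace (adjointSubspace L) = L := by
  refine (Submodule.eq_of_le_of_finrank_eq ?_ ?_).symm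
  · intro a ha
    refine mem_adjointSubspace_iff.2 fun b hb => ?_
    have := mem_adjointSubspace_iff.1 hb a ha
    rw [real_inner_comm, ← this, real_inner_comm]
  · rw [finrank_adjointSubspace (finrank_adjointSubspace hL)]
    exact hL

theorem toEuclideanLin_isSymm {A : Matrix (Fin n) (Fin n) ℝ} :
    A.IsSymm ↔ ∀ u v, inner ℝ (Matrix.toEuclideanLin A u) v =
      inner ℝ u (Matrix.toEuclideanLin A v) := by
  have : A.IsSymm ↔ A.IsHermitian := by
    rw [Matrix.IsSymm, Matrix.IsHermitian, Matrix.conjTranspose_eq_transpose_of_trivial]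
  rw [this, ← Matrix.isSymmetric_toEuclideanLin_iff]
  rfl

/-- `P` projects onto the space `U` of first components. For `(u, v) ∈ L` the vector `u + (I - P) v`
serves as a global coordinate on `L`, and `W` reads off `v` from it. -/
theorem IsIsotropic.mem_ZPW {L : Submodule ℝ (R2n n)} (h : IsIsotropic L) (hL : L ∈ Z n) :
    L ∈ ZPW n := by
  set fst : R2n n →ₗ[ℝ] Rn n := (WithLp.fstL 2 ℝ (Rn n) (Rn n)).toLinearMap
  set snd : R2n n →ₗ[ℝ] Rn n := (WithLp.sndL 2 ℝ (Rn n) (Rn n)).toLinearMap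
  set U : Submodule ℝ (Rn n) := L.map fst with hU
  set Pr : Rn n →ₗ[ℝ] Rn n := U.starProjection.toLinearMap with hPr
  have hfstU : ∀ a ∈ L, Pr a.fst = a.fst := fun a ha =>
    Submodule.starProjection_eq_self_iff.2 ⟨a, ha, rfl⟩
  have hPsymm : ∀ u v, inner ℝ (Pr u) v = inner ℝ u (Pr v) := U.starProjection_isSymmetric
  have hPP : ∀ u, Pr (Pr u) = Pr u := fun u =>
    Submodule.starProjection_eq_self_iff.2 (U.starProjection_apply_mem u)
  -- `L = L*`, and `(0, v)` with `v ⟂ U` is symplectically orthogonal to `L`.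
  have hzero : ∀ v, Pr v = 0 → pair 0 v ∈ L := by
    intro v hv
    rw [← h.adjointSubspace_eq hL]
    refine mem_adjointSubspace_iff.2 fun b hb => ?_
    change inner ℝ b.fst v = inner ℝ b.snd 0
    rw [inner_zero_right, ← hfstU b hb, hPsymm, hv, inner_zero_right]
  set Q : L →ₗ[ℝ] Rn n := (fst + (LinearMap.id - Pr) ∘ₗ snd) ∘ₗ L.subtype with hQ
  have hQa : ∀ a : L, Q a = (a : R2n n).fst + ((a : R2n n).snd - Pr (a : R2n n).snd) :=
    fun _ => rfl
  have hPQ : ∀ a : L, Pr (Q a) = (a : R2n n).fst := fun a => by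
    rw [hQa, map_add, map_sub, hPP, sub_self, add_zero, hfstU _ a.2]
  have hinj : Function.Injective Q := by
    rw [injective_iff_map_eq_zero]
    intro a ha
    have h1 : (a : R2n n).fst = 0 := by rw [← hPQ, ha, map_zero]
    have h2 : (a : R2n n).snd = Pr (a : R2n n).snd := by
      rw [hQa, h1, zero_add, sub_eq_zero] at ha
      exact ha
    -- The second component lies in `U`, so it is the first component of some `b ∈ L`; isotropy of
    -- the pair `b, a` makes its norm vanish.
    have h3 : (a : R2n n).snd = 0 := by
      have hm : (a : R2n n).snd ∈ U := by
        rw [h2]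
        exact U.starProjection_apply_mem _
      obtain ⟨b, hb, hb'⟩ := hm
      have := h b hb a a.2
      rw [h1, inner_zero_right] at this
      have hb'' : b.fst = (a : R2n n).snd := hb'
      rw [hb'', inner_self_eq_zero] at this
      exact this
    apply Subtype.ext
    rw [← pair_eta (a : R2n n), h1, h3]
    rfl
  let e : L ≃ₗ[ℝ] Rn n := LinearEquiv.ofInjectiveOfFinrankEq Q hinj (by
    rw [show Module.finrank ℝ L = n from hL]
    simp)
  have he : ∀ a, e a = Q a := fun _ => rfl
  have heQ : ∀ u, Q (e.symm u) = u := fun u => by rw [← he, e.apply_symm_apply]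
  set Wr : Rn n →ₗ[ℝ] Rn n := snd ∘ₗ L.subtype ∘ₗ e.symm.toLinearMap with hWr
  have hWa : ∀ u, Wr u = (e.symm u : R2n n).snd := fun _ => rfl
  have hPa : ∀ u, Pr u = (e.symm u : R2n n).fst := fun u => by
    rw [← hPQ, heQ]
  have hpair : ∀ u, pair (Pr u) (Wr u) = (e.symm u : R2n n) := fun u => by
    rw [hPa, hWa, pair_eta]
  have hPW : ∀ u, Wr u - Pr (Wr u) = u - Pr u := by
    intro u
    have := heQ u
    rw [hQa, ← hPa, ← hWa] at this
    rw [eq_sub_iff_add_eq', this]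
  -- Isotropy handles the part seen through `P`; on the complement, `(I - P) W = I - P` is
  -- symmetric.
  have hWsymm : ∀ u v, inner ℝ (Wr u) v = inner ℝ u (Wr v) := by
    intro u v
    have h1 := h _ (e.symm u).2 _ (e.symm v).2
    rw [← hPa, ← hWa, ← hWa, ← hPa] at h1
    have e1 : inner ℝ u (Wr v) = inner ℝ (Pr u) (Wr v) + inner ℝ u (v - Pr v) := by
      rw [hPsymm, ← inner_add_right, ← hPW, add_sub_cancel]
    have e2 : inner ℝ (Wr u) v = inner ℝ (Wr u) (Pr v) + inner ℝ (u - Pr u) v := by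
      rw [← hPsymm, ← inner_add_left, ← hPW, add_sub_cancel]
    rw [e1, e2, h1, inner_sub_left, inner_sub_right, hPsymm]
  have hWP : ∀ u, Wr (u - Pr u) = u - Pr u := by
    intro u
    have hz : Pr (u - Pr u) = 0 := by rw [map_sub, hPP, sub_self]
    have : e ⟨pair 0 (u - Pr u), hzero _ hz⟩ = u - Pr u := by
      rw [he, hQa]
      change 0 + ((u - Pr u) - Pr (u - Pr u)) = _
      rw [hz, zero_add, sub_zero]
    rw [hWa]
    nth_rw 1 [← this]
    rw [e.symm_apply_apply]
    rfl
  refine ⟨hL, Matrix.toEuclideanLin.symm Pr, Matrix.toEuclideanLin.symm Wr, ?_, ?_, ?_, ?_, ?_⟩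
  · rw [toEuclideanLin_isSymm, LinearEquiv.apply_symm_apply]
    exact hPsymm
  · rw [toEuclideanLin_isSymm, LinearEquiv.apply_symm_apply]
    exact hWsymm
  · ext z
    rw [rge, LinearEquiv.apply_symm_apply, LinearEquiv.apply_symm_apply]
    constructor
    · intro hz
      refine ⟨e ⟨z, hz⟩, ?_⟩
      change pair (Pr _) (Wr _) = z
      rw [hpair, e.symm_apply_apply]
    · rintro ⟨u, rfl⟩
      change pair (Pr _) (Wr _) ∈ L
      rw [hpair]
      exact (e.symm u).2
  · apply Matrix.toEuclideanLin.injective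
    rw [pow_two, Matrix.toLpLin_mul_same, LinearEquiv.apply_symm_apply]
    exact LinearMap.ext hPP
  · apply Matrix.toEuclideanLin.injective
    rw [Matrix.toLpLin_mul_same, map_sub, Matrix.toLpLin_one, LinearEquiv.apply_symm_apply,
      LinearEquiv.apply_symm_apply]
    exact LinearMap.ext hWP

/-- The relation `W (I - P) = I - P` gives `W P = W - I + P`, which is symmetric; so `P` and `W`
commute, and `P W` is symmetric. -/
theorem isIsotropic_of_mem_ZPW {L : Submodule ℝ (R2n n)} (h : L ∈ ZPW n) : IsIsotropic L := by
  obtain ⟨-, P, W, hP, hW, hrge, -, hWP⟩ := h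
  have hcomm : P * W = W * P := by
    have h1 : W * P = W - 1 + P := by
      rw [mul_sub, mul_one] at hWP
      rw [eq_comm, ← sub_eq_zero] at hWP
      rw [← sub_eq_zero, ← hWP]
      abel
    have h2 := congrArg Matrix.transpose h1
    rw [Matrix.transpose_mul, Matrix.transpose_add, Matrix.transpose_sub, Matrix.transpose_one,
      hP.eq, hW.eq] at h2
    rw [h1, h2]
  have hmem : ∀ a ∈ L, ∃ u, pair (Matrix.toEuclideanLin P u) (Matrix.toEuclideanLin W u) = a := by
    intro a ha
    have : a ∈ (L : Set (R2n n)) := ha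
    rw [hrge] at this
    exact this
  intro a ha b hb
  obtain ⟨u, rfl⟩ := hmem a ha
  obtain ⟨v, rfl⟩ := hmem b hb
  change inner ℝ (Matrix.toEuclideanLin P u) (Matrix.toEuclideanLin W v) =
    inner ℝ (Matrix.toEuclideanLin W u) (Matrix.toEuclideanLin P v)
  rw [toEuclideanLin_isSymm.1 hP, toEuclideanLin_isSymm.1 hW]
  have := congrArg (fun M => Matrix.toEuclideanLin M v) hcomm
  simp only [Matrix.toLpLin_mul_same, LinearMap.comp_apply] at this
  rw [this]

/-! ### Limits of subspaces -/

theorem trace_starProjection {E : Type*} [NormedAddCommGroup E]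
    [InnerProductSpace ℝ E] [FiniteDimensional ℝ E] (L : Submodule ℝ E) :
    LinearMap.trace ℝ E L.starProjection.toLinearMap = Module.finrank ℝ L := by
  have : LinearMap.IsProj L L.starProjection.toLinearMap :=
    ⟨fun x => L.starProjection_apply_mem x, fun x hx => Submodule.starProjection_eq_self_iff.2 hx⟩
  exact this.trace

/-- Orthogonal projections are the self-adjoint idempotents, a closed condition. -/
theorem exists_starProjection_eq_of_tendsto {E : Type*} [NormedAddCommGroup E]
    [InnerProductSpace ℝ E] [FiniteDimensional ℝ E] {T : ℕ → Submodule ℝ E} {p : E →L[ℝ] E}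
    (hp : Tendsto (fun k => (T k).starProjection) atTop (𝓝 p)) :
    ∃ L : Submodule ℝ E, L.starProjection = p := by
  have : CompleteSpace E := FiniteDimensional.complete ℝ E
  have hmul : IsClosed {q : E →L[ℝ] E | q * q = q} :=
    isClosed_eq (continuous_id.mul continuous_id) continuous_id
  have hadj : IsClosed {q : E →L[ℝ] E | ContinuousLinearMap.adjoint q = q} :=
    isClosed_eq ContinuousLinearMap.adjoint.continuous continuous_id
  have h (k : ℕ) := isStarProjection_iff'.1 (isStarProjection_starProjection (U := T k))
  have hstar : IsStarProjection p := isStarProjection_iff'.2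
    ⟨hmul.mem_of_tendsto hp (Eventually.of_forall fun k => (h k).1),
      hadj.mem_of_tendsto hp (Eventually.of_forall fun k => (h k).2)⟩
  obtain ⟨_, hpL⟩ := isStarProjection_iff_eq_starProjection_range.1 hstar
  exact ⟨_, hpL.symm⟩

/-- The dimension is the trace of the projection, which is continuous. -/
theorem finrank_eq_of_tendsto_starProjection {E : Type*} [NormedAddCommGroup E]
    [InnerProductSpace ℝ E] [FiniteDimensional ℝ E] {m : ℕ} {T : ℕ → Submodule ℝ E}
    (hT : ∀ k, Module.finrank ℝ (T k) = m) {L : Submodule ℝ E}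
    (h : Tendsto (fun k => (T k).starProjection) atTop (𝓝 L.starProjection)) :
    Module.finrank ℝ L = m := by
  let tr : (E →L[ℝ] E) →ₗ[ℝ] ℝ := LinearMap.trace ℝ E ∘ₗ ContinuousLinearMap.coeLM ℝ
  have h1 : Tendsto (fun k => tr (T k).starProjection) atTop (𝓝 (tr L.starProjection)) :=
    (tr.continuous_of_finiteDimensional.tendsto _).comp h
  have h2 : ∀ M : Submodule ℝ E, tr M.starProjection = Module.finrank ℝ M :=
    trace_starProjection
  simp only [h2, hT] at h1
  exact_mod_cast tendsto_nhds_unique h1 tendsto_const_nhds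

theorem exists_subseq_tendsto_dZ {T : ℕ → Submodule ℝ (R2n n)} (hT : ∀ k, T k ∈ Z n) :
    ∃ L ∈ Z n, ∃ j : ℕ → ℕ, StrictMono j ∧ Tendsto (fun k => dZ L (T (j k))) atTop (𝓝 0) := by
  have : ProperSpace (R2n n →L[ℝ] R2n n) := FiniteDimensional.proper_real _
  obtain ⟨p, -, j, hj, hp⟩ := tendsto_subseq_of_bounded
    (Metric.isBounded_closedBall (x := (0 : R2n n →L[ℝ] R2n n)) (r := 1))
    (x := fun k => (T k).starProjection)
    (fun k => by
      rw [mem_closedBall_zero_iff]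
      exact (T k).starProjection_norm_le)
  obtain ⟨L, rfl⟩ := exists_starProjection_eq_of_tendsto (T := fun k => T (j k)) hp
  refine ⟨L, finrank_eq_of_tendsto_starProjection (fun k => hT (j k)) hp, j, hj, ?_⟩
  have h := tendsto_iff_norm_sub_tendsto_zero.1 hp
  refine h.congr fun k => ?_
  rw [dZ, norm_sub_rev]
  rfl

/-- Each `a ∈ L` is the limit of its projections onto `T k`, and the symplectic form is continuous.
-/
theorem isIsotropic_of_tendsto_dZ {L : Submodule ℝ (R2n n)} {T : ℕ → Submodule ℝ (R2n n)}
    (h : Tendsto (fun k => dZ L (T k)) atTop (𝓝 0)) (hT : ∀ᶠ k in atTop, IsIsotropic (T k)) :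
    IsIsotropic L := by
  have hlim : ∀ a ∈ L, Tendsto (fun k => (T k).starProjection a) atTop (𝓝 a) := by
    intro a ha
    have h1 : Tendsto (fun k => (T k).starProjection) atTop (𝓝 L.starProjection) := by
      rw [tendsto_iff_norm_sub_tendsto_zero]
      simpa only [dZ, norm_sub_rev] using h
    have h2 := ((ContinuousLinearMap.apply ℝ (R2n n) a).continuous.tendsto _).comp h1
    simpa [Function.comp_def, Submodule.starProjection_eq_self_iff.2 ha] using h2
  have hf : Continuous fun a : R2n n => a.fst := (WithLp.fstL 2 ℝ (Rn n) (Rn n)).continuous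
  have hs : Continuous fun a : R2n n => a.snd := (WithLp.sndL 2 ℝ (Rn n) (Rn n)).continuous
  intro a ha b hb
  refine tendsto_nhds_unique_of_eventuallyEq
    (((hf.tendsto _).comp (hlim a ha)).inner ((hs.tendsto _).comp (hlim b hb)))
    (((hs.tendsto _).comp (hlim a ha)).inner ((hf.tendsto _).comp (hlim b hb))) ?_
  filter_upwards [hT] with k hk
  exact hk _ ((T k).starProjection_apply_mem a) _ ((T k).starProjection_apply_mem b)

/-! ### Tangent cones to sets that are Lipschitz graphs in sheared coordinates -/

/-- The linear map `(x, v) ↦ v + r x`. -/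
noncomputable def shear (r : ℝ) : R2n n →L[ℝ] Rn n :=
  WithLp.sndL 2 ℝ (Rn n) (Rn n) + r • WithLp.fstL 2 ℝ (Rn n) (Rn n)

theorem shear_apply (r : ℝ) (z : R2n n) : shear r z = z.snd + r • z.fst := rfl

theorem shear_pair_sub (r : ℝ) (x s : Rn n) : shear r (pair x (s - r • x)) = s := by
  rw [shear_apply]
  exact sub_add_cancel _ _

theorem pair_shear (r : ℝ) (z : R2n n) : pair z.fst (shear r z - r • z.fst) = z := by
  rw [shear_apply, add_sub_cancel_right, pair_eta]

/-- The linear map `a ↦ (B a, a - r B a)`. -/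
def graphMap (r : ℝ) (B : Rn n →ₗ[ℝ] Rn n) : Rn n →ₗ[ℝ] R2n n where
  toFun a := pair (B a) (a - r • B a)
  map_add' a b := by
    rw [← pair_add, map_add, smul_add, add_sub_add_comm]
  map_smul' c a := by
    rw [RingHom.id_apply, ← pair_smul, map_smul, smul_sub, smul_comm r c]

theorem graphMap_apply (r : ℝ) (B : Rn n →ₗ[ℝ] Rn n) (a : Rn n) :
    graphMap r B a = pair (B a) (a - r • B a) := rfl

theorem range_graphMap_mem_Z (r : ℝ) (B : Rn n →ₗ[ℝ] Rn n) :
    LinearMap.range (graphMap r B) ∈ Z n := by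
  have hinj : Function.Injective (graphMap r B) :=
    Function.LeftInverse.injective (g := shear r) fun a => shear_pair_sub r (B a) a
  have := LinearMap.finrank_range_of_inj hinj
  rw [finrank_euclideanSpace_fin] at this
  exact this

theorem isIsotropic_range_graphMap (r : ℝ) {B : Rn n →ₗ[ℝ] Rn n} (hB : B.IsSymmetric) :
    IsIsotropic (LinearMap.range (graphMap r B)) := by
  rintro _ ⟨a, rfl⟩ _ ⟨b, rfl⟩
  change inner ℝ (B a) (b - r • B b) = inner ℝ (a - r • B a) (B b)
  rw [inner_sub_left, inner_sub_right, real_inner_smul_left, real_inner_smul_right, hB a b]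

/-- Near `w`, the set `G` is the graph of the Lipschitz function `p`, in the coordinates
`(v + r x, x)` of the pair `(x, v)`. -/
structure IsLocalParam (G : Set (R2n n)) (r : ℝ) (K : NNReal) (p : Rn n → Rn n) (w : R2n n) :
    Prop where
  lipschitz : LipschitzWith K p
  eq_fst : ∀ᶠ z in 𝓝 w, z ∈ G → p (shear r z) = z.fst
  mem : ∀ᶠ s in 𝓝 (shear r w), pair (p s) (s - r • p s) ∈ G

variable {G : Set (R2n n)} {r : ℝ} {K : NNReal} {p : Rn n → Rn n} {w : R2n n}

theorem IsLocalParam.eventually (h : IsLocalParam G r K p w) :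
    ∀ᶠ z in 𝓝 w, IsLocalParam G r K p z := by
  filter_upwards [h.eq_fst.eventually_nhds,
    ((shear r).continuous.tendsto w).eventually h.mem.eventually_nhds] with z h1 h2
  exact ⟨h.lipschitz, h1, h2⟩

/-- Stated for filters because differentiability of `p` is later tested along ultrafilters. -/
theorem mem_posTangentConeAt_of_tendsto {α : Type*} {l : Filter α} [l.NeBot] {t : α → ℝ}
    {y : α → R2n n} {u : R2n n} (ht : ∀ᶠ k in l, 0 < t k) (ht0 : Tendsto t l (𝓝 0))
    (hy : ∀ᶠ k in l, w + y k ∈ G) (hu : Tendsto (fun k => (t k)⁻¹ • y k) l (𝓝 u)) :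
    u ∈ posTangentConeAt G w := by
  refine mem_tangentConeAt_of_seq l (fun k => (t k)⁻¹.toNNReal) y ?_ hy ?_
  · have := ht0.smul hu
    rw [zero_smul] at this
    refine this.congr' ?_
    filter_upwards [ht] with k hk
    rw [smul_inv_smul₀ hk.ne']
  · refine hu.congr' ?_
    filter_upwards [ht] with k hk
    rw [NNReal.smul_def, Real.coe_toNNReal _ (inv_pos.2 hk).le]

theorem IsLocalParam.exists_seq (h : IsLocalParam G r K p w) (hw : w ∈ G) {u : R2n n}
    (hu : u ∈ posTangentConeAt G w) :
    ∃ (t : ℕ → ℝ) (a : ℕ → Rn n), (∀ k, 0 < t k) ∧ Tendsto t atTop (𝓝 0) ∧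
      Tendsto a atTop (𝓝 (shear r u)) ∧
      Tendsto (fun k => (t k)⁻¹ • (p (shear r w + t k • a k) - p (shear r w))) atTop
        (𝓝 u.fst) := by
  obtain ⟨t, y, ht, ht0, hy, hG⟩ := (mem_posTangentConeAt_iff_seq hw u).1 hu
  refine ⟨t, fun k => shear r (y k), ht, ht0, ((shear r).continuous.tendsto u).comp hy, ?_⟩
  have hlim : Tendsto (fun k => w + t k • y k) atTop (𝓝 w) := by
    simpa using tendsto_const_nhds.add (ht0.smul hy)
  have hfst := ((WithLp.fstL 2 ℝ (Rn n) (Rn n)).continuous.tendsto u).comp hy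
  refine hfst.congr' ?_
  filter_upwards [hlim.eventually h.eq_fst] with k hk
  have h1 := hk (hG k)
  rw [map_add, map_smul] at h1
  rw [h1, h.eq_fst.self_of_nhds hw]
  change (y k).fst = (t k)⁻¹ • (w.fst + t k • (y k).fst - w.fst)
  rw [add_sub_cancel_left, inv_smul_smul₀ (ht k).ne']

theorem tendsto_pair {α : Type*} {l : Filter α} {u v : α → Rn n} {u₀ v₀ : Rn n}
    (hu : Tendsto u l (𝓝 u₀)) (hv : Tendsto v l (𝓝 v₀)) :
    Tendsto (fun k => pair (u k) (v k)) l (𝓝 (pair u₀ v₀)) :=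
  ((WithLp.prod_continuous_toLp 2 (Rn n) (Rn n)).tendsto (u₀, v₀)).comp (hu.prodMk_nhds hv)

theorem IsLocalParam.mem_posTangentConeAt (h : IsLocalParam G r K p w) (hw : w ∈ G)
    {α : Type*} {l : Filter α} [l.NeBot] {t : α → ℝ} {b : α → Rn n} {a u : Rn n}
    (ht : ∀ᶠ k in l, 0 < t k) (ht0 : Tendsto t l (𝓝 0))
    (ha : Tendsto (fun k => (t k)⁻¹ • b k) l (𝓝 a))
    (hu : Tendsto (fun k => (t k)⁻¹ • (p (shear r w + b k) - p (shear r w))) l (𝓝 u)) :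
    pair u (a - r • u) ∈ posTangentConeAt G w := by
  have hb : Tendsto (fun k => shear r w + b k) l (𝓝 (shear r w)) := by
    have := ht0.smul ha
    rw [zero_smul] at this
    have h0 : Tendsto b l (𝓝 0) := this.congr' (by
      filter_upwards [ht] with k hk
      rw [smul_inv_smul₀ hk.ne'])
    simpa using tendsto_const_nhds.add h0
  refine mem_posTangentConeAt_of_tendsto (l := l) (t := t)
    (y := fun k => pair (p (shear r w + b k) - p (shear r w))
      (b k - r • (p (shear r w + b k) - p (shear r w)))) ht ht0 ?_ ?_
  · filter_upwards [hb.eventually h.mem] with k hk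
    convert hk using 1
    nth_rw 1 [← pair_shear r w]
    rw [← h.eq_fst.self_of_nhds hw, ← pair_add, add_sub_cancel, smul_sub]
    congr 1
    abel_nf
  · refine (tendsto_pair hu (ha.sub (hu.const_smul r))).congr fun k => ?_
    rw [← pair_smul, smul_sub (t k)⁻¹ (b k), smul_comm r]

/-- At points of differentiability of `p` the tangent cone is a subspace. -/
theorem IsLocalParam.posTangentConeAt_eq (h : IsLocalParam G r K p w) (hw : w ∈ G)
    {B : Rn n →L[ℝ] Rn n} (hB : HasFDerivAt p B (shear r w)) :
    posTangentConeAt G w = LinearMap.range (graphMap r B.toLinearMap) := by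
  have hlim {t : ℕ → ℝ} {a : ℕ → Rn n} {a₀ : Rn n} (ht : ∀ k, 0 < t k)
      (ht0 : Tendsto t atTop (𝓝 0)) (ha : Tendsto a atTop (𝓝 a₀)) :
      Tendsto (fun k => (t k)⁻¹ • (p (shear r w + t k • a k) - p (shear r w))) atTop
        (𝓝 (B a₀)) := by
    refine hB.hasFDerivWithinAt.lim (s := Set.univ) ?_
      (Eventually.of_forall fun _ => Set.mem_univ _) ?_
    · simpa using ht0.smul ha
    · simpa only [inv_smul_smul₀ (ht _).ne'] using ha
  ext u
  constructor
  · intro hu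
    obtain ⟨t, a, ht, ht0, ha, hp⟩ := h.exists_seq hw hu
    refine ⟨shear r u, ?_⟩
    rw [graphMap_apply, ← pair_shear r u]
    have := tendsto_nhds_unique hp (hlim ht ht0 ha)
    rw [shear_pair_sub, this]
    rfl
  · rintro ⟨a, rfl⟩
    have ht (k : ℕ) : (0 : ℝ) < 1 / ((k : ℝ) + 1) := by positivity
    refine h.mem_posTangentConeAt hw (l := atTop) (t := fun k : ℕ => 1 / ((k : ℝ) + 1))
      (b := fun k : ℕ => (1 / ((k : ℝ) + 1)) • a) (Eventually.of_forall ht)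
      tendsto_one_div_add_atTop_nhds_zero_nat ?_
      (hlim ht tendsto_one_div_add_atTop_nhds_zero_nat tendsto_const_nhds)
    simpa only [inv_smul_smul₀ (ht _).ne'] using tendsto_const_nhds

/-- If the tangent cone is an `n`-dimensional subspace, it is the graph of a linear map. -/
theorem IsLocalParam.exists_linear (h : IsLocalParam G r K p w) (hw : w ∈ G)
    {L : Submodule ℝ (R2n n)} (hL : L ∈ Z n) (hT : (L : Set (R2n n)) = posTangentConeAt G w) :
    ∃ B : Rn n →L[ℝ] Rn n, ∀ u a, pair u (a - r • u) ∈ posTangentConeAt G w → B a = u := by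
  -- Tangent vectors inherit the Lipschitz bound of `p`. Hence `shear r` is injective on `L`, and
  -- bijective by dimension; `B` is the first component of its inverse.
  have hbound : ∀ u ∈ L, ‖u.fst‖ ≤ K * ‖shear r u‖ := by
    intro u hu
    have hu' : u ∈ posTangentConeAt G w := hT ▸ hu
    obtain ⟨t, a, ht, -, ha, hp⟩ := h.exists_seq hw hu'
    refine le_of_tendsto_of_tendsto' hp.norm (ha.norm.const_mul (K : ℝ)) fun k => ?_
    have := h.lipschitz.norm_sub_le (shear r w + t k • a k) (shear r w)
    rw [add_sub_cancel_left, norm_smul, Real.norm_of_nonneg (ht k).le] at this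
    rw [norm_smul, norm_inv, Real.norm_of_nonneg (ht k).le, inv_mul_le_iff₀ (ht k)]
    linarith
  have hinj : Function.Injective ((shear r).toLinearMap ∘ₗ L.subtype) := by
    rw [injective_iff_map_eq_zero]
    intro u hu
    have hu' : shear r (u : R2n n) = 0 := hu
    have h1 := hbound u u.2
    rw [hu', norm_zero, mul_zero, norm_le_zero_iff] at h1
    apply Subtype.ext
    rw [← pair_shear r (u : R2n n), hu', h1, smul_zero, sub_zero, pair_zero]
    rfl
  let e : L ≃ₗ[ℝ] Rn n := LinearEquiv.ofInjectiveOfFinrankEq _ hinj (by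
    rw [finrank_euclideanSpace_fin]
    exact hL)
  refine ⟨LinearMap.toContinuousLinearMap
    ((WithLp.fstL 2 ℝ (Rn n) (Rn n)).toLinearMap ∘ₗ L.subtype ∘ₗ e.symm.toLinearMap), ?_⟩
  intro u a hu
  rw [← hT] at hu
  have : e ⟨_, hu⟩ = a := shear_pair_sub r u a
  change ((e.symm a : L) : R2n n).fst = u
  rw [← this, e.symm_apply_apply]
  rfl

/-- If the remainder is not `o(‖b‖)`, some ultrafilter keeps it above `ε ‖b‖`. By compactness,
directions and difference quotients converge along it, and the hypothesis forces the limit remainder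
to be zero. -/
theorem _root_.LipschitzWith.hasFDerivAt_of_ultrafilter {E F : Type*} [NormedAddCommGroup E]
    [NormedSpace ℝ E] [ProperSpace E] [NormedAddCommGroup F] [NormedSpace ℝ F] [ProperSpace F]
    {K : NNReal} {f : E → F} (hf : LipschitzWith K f) {x : E} {B : E →L[ℝ] F}
    (hB : ∀ (l : Ultrafilter E) (a : E) (u : F), (∀ᶠ b in (l : Filter E), 0 < ‖b‖) →
      Tendsto (fun b : E => ‖b‖) l (𝓝 0) → Tendsto (fun b : E => ‖b‖⁻¹ • b) l (𝓝 a) →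
      Tendsto (fun b => ‖b‖⁻¹ • (f (x + b) - f x)) l (𝓝 u) → B a = u) :
    HasFDerivAt f B x := by
  rw [hasFDerivAt_iff_isLittleO_nhds_zero, Asymptotics.isLittleO_iff]
  by_contra hcon
  push Not at hcon
  obtain ⟨ε, hε, hfr⟩ := hcon
  have hne := frequently_iff_neBot.1 hfr
  obtain ⟨l, hl⟩ := Ultrafilter.exists_le
    (𝓝 0 ⊓ 𝓟 {b | ε * ‖b‖ < ‖f (x + b) - f x - B b‖})
  have hl0 : Tendsto id (l : Filter E) (𝓝 0) := hl.trans inf_le_left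
  have hlS : ∀ᶠ b in (l : Filter E), ε * ‖b‖ < ‖f (x + b) - f x - B b‖ :=
    hl (mem_inf_of_right (mem_principal_self _))
  have hpos : ∀ᶠ b in (l : Filter E), 0 < ‖b‖ := by
    filter_upwards [hlS] with b hb
    rw [norm_pos_iff]
    rintro rfl
    simp at hb
  obtain ⟨a, -, ha⟩ := (isCompact_closedBall (0 : E) 1).ultrafilter_le_nhds'
    (l.map fun b => ‖b‖⁻¹ • b) (by
      rw [Ultrafilter.mem_map]
      refine Filter.univ_mem' fun b => ?_
      change _ ∈ Metric.closedBall _ _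
      rw [mem_closedBall_zero_iff, norm_smul, norm_inv, norm_norm]
      exact inv_mul_le_one)
  obtain ⟨u, -, hu⟩ := (isCompact_closedBall (0 : F) K).ultrafilter_le_nhds'
    (l.map fun b => ‖b‖⁻¹ • (f (x + b) - f x)) (by
      rw [Ultrafilter.mem_map]
      filter_upwards [hpos] with b hb
      change _ ∈ Metric.closedBall _ _
      rw [mem_closedBall_zero_iff, norm_smul, norm_inv, norm_norm, inv_mul_le_iff₀ hb, mul_comm]
      simpa using hf.norm_sub_le (x + b) x)
  have hu' : Tendsto (fun b => ‖b‖⁻¹ • (f (x + b) - f x)) l (𝓝 u) := hu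
  have ha' : Tendsto (fun b : E => ‖b‖⁻¹ • b) l (𝓝 a) := ha
  have hBa : B a = u := hB l a u hpos (by simpa using hl0.norm) ha' hu'
  have hlim := (hu'.sub ((B.continuous.tendsto a).comp ha')).norm
  rw [hBa, sub_self, norm_zero] at hlim
  refine absurd (ge_of_tendsto (b := ε) hlim ?_) (not_le.2 hε)
  filter_upwards [hlS, hpos] with b hb hb0
  rw [Function.comp_apply, map_smul, ← smul_sub, norm_smul, norm_inv, norm_norm,
    le_inv_mul_iff₀ hb0, mul_comm]
  exact hb.le

/-- If the tangent cone is an `n`-dimensional subspace, then `p` is differentiable. -/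
theorem IsLocalParam.exists_hasFDerivAt (h : IsLocalParam G r K p w) (hw : w ∈ G)
    {L : Submodule ℝ (R2n n)} (hL : L ∈ Z n) (hT : (L : Set (R2n n)) = posTangentConeAt G w) :
    ∃ B : Rn n →L[ℝ] Rn n, HasFDerivAt p B (shear r w) := by
  obtain ⟨B, hB⟩ := h.exists_linear hw hL hT
  refine ⟨B, h.lipschitz.hasFDerivAt_of_ultrafilter fun l a u hpos h0 ha hu => hB u a ?_⟩
  exact h.mem_posTangentConeAt hw (b := id) hpos h0 ha hu

/-! ### The localized proximal mapping of a prox-regular function -/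

/-- A quadratic minorant bounds the quotient below by `-c ‖y - x‖`, which tends to zero. -/
theorem mem_regularSubdiff_of_eventually {q : Rn n → EReal} {x v : Rn n} {f c : ℝ}
    (hx : q x = f)
    (h : ∀ᶠ y in 𝓝 x, ((f + (inner ℝ v (y - x) - c * ‖y - x‖ ^ 2) : ℝ) : EReal) ≤ q y) :
    v ∈ regularSubdiff q x := by
  refine ⟨hx ▸ EReal.coe_lt_top f, ?_⟩
  refine le_of_forall_lt_imp_le_of_dense fun a ha => ?_
  obtain ⟨η, haη, hη⟩ := EReal.lt_iff_exists_real_btwn.1 ha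
  refine haη.le.trans (le_liminf_of_le (by isBoundedDefault) ?_)
  have hη0 : η < 0 := by exact_mod_cast hη
  have hcont : Tendsto (fun y => -c * ‖y - x‖) (𝓝 x) (𝓝 0) := by
    have : Continuous fun y => -c * ‖y - x‖ := by fun_prop
    simpa using this.tendsto x
  filter_upwards [eventually_nhdsWithin_of_eventually_nhds h, eventually_mem_nhdsWithin,
    eventually_nhdsWithin_of_eventually_nhds (hcont.eventually (lt_mem_nhds hη0))]
    with y hy hne hlt
  have hpos : 0 < ‖y - x‖ := norm_pos_iff.2 (sub_ne_zero.2 hne)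
  rw [EReal.le_div_iff_mul_le (by exact_mod_cast hpos) (EReal.coe_ne_top _), hx]
  induction hqy : q y with
  | bot =>
    rw [hqy] at hy
    exact absurd (le_bot_iff.1 hy) (EReal.coe_ne_bot _)
  | top => exact le_top
  | coe g =>
    rw [hqy] at hy
    have hy' := EReal.coe_le_coe_iff.1 hy
    norm_cast
    nlinarith

theorem regularSubdiff_subset_subdiff (q : Rn n → EReal) (x : Rn n) :
    regularSubdiff q x ⊆ subdiff q x := fun v hv =>
  ⟨hv.1, fun _ => x, fun _ => v, tendsto_const_nhds, tendsto_const_nhds, fun _ => hv,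
    tendsto_const_nhds⟩

theorem coe_toReal_of_mem_subdiff {q : Rn n → EReal} (hq : ∀ x, q x ≠ ⊥) {x v : Rn n}
    (hv : v ∈ subdiff q x) : ((q x).toReal : EReal) = q x :=
  EReal.coe_toReal hv.1.ne (hq x)

/-- The prox-regularity inequality holds, with uniform constants, on a neighbourhood of
`(xb, vb)`. -/
def IsProxRegularNear (q : Rn n → EReal) (ε ρ : ℝ) (xb vb : Rn n) : Prop :=
  ∀ x v, v ∈ subdiff q x → ‖x - xb‖ ≤ ε → ‖v - vb‖ ≤ ε → ∀ x', ‖x' - xb‖ ≤ ε →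
    (((q x).toReal + (inner ℝ v (x' - x) - ρ / 2 * ‖x' - x‖ ^ 2) : ℝ) : EReal) ≤ q x'

theorem IsSubdiffContinuousAt.exists_forall {q : Rn n → EReal} (hq : ∀ x, q x ≠ ⊥)
    {xb vb : Rn n} (h : IsSubdiffContinuousAt q xb vb) {ε : ℝ} (hε : 0 < ε) :
    ∃ δ > (0 : ℝ), ∀ x v, v ∈ subdiff q x → ‖x - xb‖ ≤ δ → ‖v - vb‖ ≤ δ →
      q x ≤ q xb + (ε : EReal) ∧ q xb ≤ q x + (ε : EReal) := by
  by_contra! hcon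
  have hpos (k : ℕ) : (0 : ℝ) < 1 / ((k : ℝ) + 1) := by positivity
  choose x v hv hx hvb hne using fun k : ℕ => hcon _ (hpos k)
  have hlim := h.2 x v hv
    (tendsto_iff_norm_sub_tendsto_zero.2 (squeeze_zero (fun _ => norm_nonneg _) hx
      tendsto_one_div_add_atTop_nhds_zero_nat))
    (tendsto_iff_norm_sub_tendsto_zero.2 (squeeze_zero (fun _ => norm_nonneg _) hvb
      tendsto_one_div_add_atTop_nhds_zero_nat))
  obtain ⟨f, hf⟩ : ∃ f : ℝ, q xb = f := ⟨_, (coe_toReal_of_mem_subdiff hq h.1).symm⟩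
  rw [hf] at hlim hne
  have h1 : ∀ᶠ k in atTop, q (x k) < ((f + ε : ℝ) : EReal) :=
    hlim.eventually (gt_mem_nhds (by exact_mod_cast (by linarith : f < f + ε)))
  have h2 : ∀ᶠ k in atTop, ((f - ε : ℝ) : EReal) < q (x k) :=
    hlim.eventually (lt_mem_nhds (by exact_mod_cast (by linarith : f - ε < f)))
  obtain ⟨k, hk1, hk2⟩ := (h1.and h2).exists
  have hk := hne k
  rw [← coe_toReal_of_mem_subdiff hq (hv k)] at hk hk1 hk2
  norm_cast at hk hk1 hk2
  have := hk hk1.le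
  linarith

/-- Subdifferential continuity makes the restriction on function values in prox-regularity automatic
near `z`. -/
theorem exists_isProxRegularNear {q : Rn n → EReal} (hq : ∀ x, q x ≠ ⊥) {z : R2n n}
    (hz : z ∈ proxreg q) : ∃ ε > (0 : ℝ), ∃ ρ ≥ (0 : ℝ), IsProxRegularNear q ε ρ z.fst z.snd := by
  obtain ⟨-, ⟨-, ε, hε, ρ, hρ, hprox⟩, hcont⟩ := hz
  obtain ⟨δ, hδ, h⟩ := hcont.exists_forall hq hε
  refine ⟨min ε δ, lt_min hε hδ, ρ, hρ, fun x v hv hx hvb x' hx' => ?_⟩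
  obtain ⟨h1, h2⟩ := h x v hv (hx.trans (min_le_right _ _)) (hvb.trans (min_le_right _ _))
  have := hprox x' (mem_closedBall_iff_norm.2 (hx'.trans (min_le_left _ _))) x
    (mem_closedBall_iff_norm.2 (hx.trans (min_le_left _ _))) h1 h2 v
    ⟨hv, mem_closedBall_iff_norm.2 (hvb.trans (min_le_left _ _))⟩
  rwa [← coe_toReal_of_mem_subdiff hq hv, ← EReal.coe_add] at this

/-- Existence of proximal points: minimize `q + r/2 ‖·‖² - ⟨s, ·⟩` over a ball, `r = ρ + 1`. -/
theorem IsProxRegularNear.exists_proximal {q : Rn n → EReal} (hq : ∀ x, q x ≠ ⊥)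
    (hlsc : LowerSemicontinuous q) {ε ρ : ℝ} {xb vb : Rn n}
    (h : IsProxRegularNear q ε ρ xb vb) (hvb : vb ∈ subdiff q xb) {s : Rn n}
    (hs : 2 * ‖s - (vb + (ρ + 1) • xb)‖ < ε) :
    ∃ x, ‖x - xb‖ ≤ 2 * ‖s - (vb + (ρ + 1) • xb)‖ ∧ s - (ρ + 1) • x ∈ subdiff q x := by
  have hε : 0 < ε := lt_of_le_of_lt (by positivity) hs
  set c : Rn n → ℝ := fun x => (ρ + 1) / 2 * ‖x‖ ^ 2 - inner ℝ s x with hc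
  have hccont : Continuous c := by fun_prop
  have hcsub (x y : Rn n) : c y - c x =
      (ρ + 1) / 2 * ‖y - x‖ ^ 2 - inner ℝ (s - (ρ + 1) • x) (y - x) := by
    have h1 : ‖y‖ ^ 2 = ‖x‖ ^ 2 + 2 * inner ℝ x (y - x) + ‖y - x‖ ^ 2 := by
      rw [← norm_add_sq_real, add_sub_cancel]
    simp only [hc, h1, inner_sub_left, inner_sub_right, real_inner_smul_left]
    ring
  have hg : LowerSemicontinuous fun x => q x + (c x : EReal) :=
    hlsc.add' (continuous_coe_real_ereal.comp hccont).lowerSemicontinuous fun x =>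
      EReal.continuousAt_add (Or.inr (EReal.coe_ne_bot _)) (Or.inr (EReal.coe_ne_top _))
  obtain ⟨x, hxball, hmin⟩ := LowerSemicontinuousOn.exists_isMinOn
    (Metric.nonempty_closedBall.2 hε.le) (isCompact_closedBall xb ε)
    (hg.lowerSemicontinuousOn _)
  have hmin' : ∀ y, ‖y - xb‖ ≤ ε → q x + (c x : EReal) ≤ q y + (c y : EReal) := fun y hy =>
    hmin (mem_closedBall_iff_norm.2 hy)
  have hxb : ((q xb).toReal : EReal) = q xb := coe_toReal_of_mem_subdiff hq hvb
  have hmin_b := hmin' xb (by rw [sub_self, norm_zero]; exact hε.le)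
  obtain ⟨f, hf⟩ : ∃ f : ℝ, q x = f := by
    refine ⟨(q x).toReal, (EReal.coe_toReal (fun htop => ?_) (hq x)).symm⟩
    rw [htop, EReal.top_add_coe, ← hxb, ← EReal.coe_add] at hmin_b
    exact EReal.coe_ne_top _ (top_le_iff.1 hmin_b)
  have hprox := h xb vb hvb (by rw [sub_self, norm_zero]; exact hε.le)
    (by rw [sub_self, norm_zero]; exact hε.le) x (mem_closedBall_iff_norm.1 hxball)
  -- Minimality against `xb` and prox-regularity at `(xb, vb)` leave `‖x - xb‖² / 2 ≤ ⟨s - vb - (ρ +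
  -- 1) xb, x - xb⟩`; then Cauchy–Schwarz.
  have hnear : ‖x - xb‖ ≤ 2 * ‖s - (vb + (ρ + 1) • xb)‖ := by
    rw [hf, ← hxb] at hmin_b
    rw [hf] at hprox
    norm_cast at hmin_b hprox
    have h1 := hcsub xb x
    have h2 := real_inner_le_norm (s - (vb + (ρ + 1) • xb)) (x - xb)
    have h3 : inner ℝ (s - (vb + (ρ + 1) • xb)) (x - xb) =
        inner ℝ (s - (ρ + 1) • xb) (x - xb) - inner ℝ vb (x - xb) := by
      rw [← inner_sub_left, sub_sub, add_comm vb]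
    have h4 : ‖x - xb‖ * ‖x - xb‖ ≤ 2 * ‖s - (vb + (ρ + 1) • xb)‖ * ‖x - xb‖ := by
      nlinarith
    rcases (norm_nonneg (x - xb)).eq_or_lt with h0 | h0
    · rw [← h0]
      positivity
    · exact le_of_mul_le_mul_right h4 h0
  refine ⟨x, hnear, regularSubdiff_subset_subdiff q x
    (mem_regularSubdiff_of_eventually (c := (ρ + 1) / 2) hf ?_)⟩
  -- The minimizer is interior to the ball, so it is a local minimizer without constraint and `q`
  -- has a quadratic minorant at `x`.
  have hnhds : ∀ᶠ y in 𝓝 x, ‖y - xb‖ < ε := by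
    have : Continuous fun y : Rn n => ‖y - xb‖ := by fun_prop
    exact (this.tendsto x).eventually (gt_mem_nhds (hnear.trans_lt hs))
  filter_upwards [hnhds] with y hy
  have hy' := hmin' y hy.le
  rw [hf] at hy'
  have h1 := hcsub x y
  induction hqy : q y with
  | bot => exact absurd hqy (hq y)
  | top => exact le_top
  | coe g =>
    rw [hqy] at hy'
    norm_cast at hy' ⊢
    linarith

theorem IsProxRegularNear.toReal_le {q : Rn n → EReal} (hq : ∀ x, q x ≠ ⊥) {ε ρ : ℝ}
    {xb vb : Rn n} (h : IsProxRegularNear q ε ρ xb vb) {x v x' v' : Rn n} (hv : v ∈ subdiff q x)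
    (hx : ‖x - xb‖ ≤ ε) (hvb : ‖v - vb‖ ≤ ε) (hv' : v' ∈ subdiff q x') (hx' : ‖x' - xb‖ ≤ ε) :
    (q x).toReal + (inner ℝ v (x' - x) - ρ / 2 * ‖x' - x‖ ^ 2) ≤ (q x').toReal := by
  have := h x v hv hx hvb x' hx'
  rw [← coe_toReal_of_mem_subdiff hq hv'] at this
  exact_mod_cast this

/-- The localized subdifferential plus `(ρ + 1) I` is strongly monotone. -/
theorem IsProxRegularNear.norm_sub_le {q : Rn n → EReal} (hq : ∀ x, q x ≠ ⊥) {ε ρ : ℝ}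
    {xb vb : Rn n} (h : IsProxRegularNear q ε ρ xb vb) {x v x' v' : Rn n} (hv : v ∈ subdiff q x)
    (hx : ‖x - xb‖ ≤ ε) (hvb : ‖v - vb‖ ≤ ε) (hv' : v' ∈ subdiff q x') (hx' : ‖x' - xb‖ ≤ ε)
    (hvb' : ‖v' - vb‖ ≤ ε) :
    ‖x' - x‖ ≤ ‖(v' + (ρ + 1) • x') - (v + (ρ + 1) • x)‖ := by
  have h1 := h.toReal_le hq hv hx hvb hv' hx'
  have h2 := h.toReal_le hq hv' hx' hvb' hv hx
  rw [norm_sub_rev x x', ← neg_sub x' x, inner_neg_right] at h2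
  have h3 : inner ℝ ((v' + (ρ + 1) • x') - (v + (ρ + 1) • x)) (x' - x) =
      inner ℝ v' (x' - x) - inner ℝ v (x' - x) + (ρ + 1) * ‖x' - x‖ ^ 2 := by
    rw [add_sub_add_comm, ← smul_sub, inner_add_left, inner_sub_left, real_inner_smul_left,
      real_inner_self_eq_norm_sq]
  have h4 := real_inner_le_norm ((v' + (ρ + 1) • x') - (v + (ρ + 1) • x)) (x' - x)
  -- The sum of the two prox-regularity inequalities is `⟨v' - v, x' - x⟩ ≥ -ρ ‖x' - x‖²`; the shift
  -- by `ρ + 1` leaves modulus one.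
  have h5 : ‖x' - x‖ * ‖x' - x‖ ≤ ‖(v' + (ρ + 1) • x') - (v + (ρ + 1) • x)‖ * ‖x' - x‖ := by
    nlinarith
  rcases (norm_nonneg (x' - x)).eq_or_lt with h0 | h0
  · rw [← h0]
    positivity
  · exact le_of_mul_le_mul_right h5 h0

theorem hasFDerivAt_of_forall_abs_le {E : Type*} [NormedAddCommGroup E] [NormedSpace ℝ E]
    {f : E → ℝ} {f' : E →L[ℝ] ℝ} {x : E}
    (h : ∀ᶠ y in 𝓝 x, |f y - f x - f' (y - x)| ≤ ‖y - x‖ ^ 2) : HasFDerivAt f f' x := by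
  refine HasFDerivAt.of_isLittleO ?_
  refine Asymptotics.IsBigO.trans_isLittleO (Asymptotics.IsBigO.of_bound 1 ?_)
    (Asymptotics.isLittleO_pow_sub_sub x one_lt_two)
  filter_upwards [h] with y hy
  rw [one_mul, norm_pow, norm_norm]
  exact hy

/-- The localized proximal mapping is the gradient of a conjugate function. -/
theorem IsProxRegularNear.exists_potential {q : Rn n → EReal} (hq : ∀ x, q x ≠ ⊥) {ε ρ : ℝ}
    {xb vb : Rn n} (h : IsProxRegularNear q ε ρ xb vb) {V : Set (Rn n)} (hV : IsOpen V)
    {p : Rn n → Rn n} (hp : ∀ s ∈ V, s - (ρ + 1) • p s ∈ subdiff q (p s))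
    (hpx : ∀ s ∈ V, ‖p s - xb‖ ≤ ε) (hpv : ∀ s ∈ V, ‖s - (ρ + 1) • p s - vb‖ ≤ ε)
    (hlip : ∀ s ∈ V, ∀ t ∈ V, ‖p t - p s‖ ≤ ‖t - s‖) :
    ∃ e : Rn n → ℝ, ∀ s ∈ V, HasFDerivAt e (innerSL ℝ (p s)) s := by
  -- The value at `s` of the localized conjugate of `q + (ρ + 1)/2 ‖·‖²`, attained at `p s`.
  set e : Rn n → ℝ := fun s =>
    inner ℝ (p s) s - (ρ + 1) / 2 * ‖p s‖ ^ 2 - (q (p s)).toReal with he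
  have key : ∀ s ∈ V, ∀ t ∈ V, 0 ≤ e t - e s - inner ℝ (p s) (t - s) := by
    intro s hs t ht
    have h1 := h.toReal_le hq (hp t ht) (hpx t ht) (hpv t ht) (hp s hs) (hpx s hs)
    have h2 : ‖p s‖ ^ 2 = ‖p t‖ ^ 2 + 2 * inner ℝ (p t) (p s - p t) + ‖p s - p t‖ ^ 2 := by
      rw [← norm_add_sq_real, add_sub_cancel]
    have h3 : inner ℝ (t - (ρ + 1) • p t) (p s - p t) =
        inner ℝ (p s) t - inner ℝ (p t) t - (ρ + 1) * inner ℝ (p t) (p s - p t) := by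
      rw [inner_sub_left, real_inner_smul_left, inner_sub_right t, real_inner_comm t,
        real_inner_comm t]
    have h4 : inner ℝ (p s) (t - s) = inner ℝ (p s) t - inner ℝ (p s) s := inner_sub_right _ _ _
    have h5 := sq_nonneg ‖p s - p t‖
    simp only [he]
    rw [h3] at h1
    rw [h4, h2]
    nlinarith
  refine ⟨e, fun s hs => hasFDerivAt_of_forall_abs_le ?_⟩
  filter_upwards [hV.mem_nhds hs] with t ht
  rw [innerSL_apply_apply, abs_of_nonneg (key s hs t ht)]
  -- The subgradient inequality with `s` and `t` exchanged bounds the remainder above by `⟨p t - p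
  -- s, t - s⟩ ≤ ‖t - s‖²`.
  have h1 := key t ht s hs
  have h2 : inner ℝ (p t) (s - t) = - inner ℝ (p t - p s) (t - s) - inner ℝ (p s) (t - s) := by
    rw [inner_sub_left, ← neg_sub t s, inner_neg_right]
    ring
  have h3 := real_inner_le_norm (p t - p s) (t - s)
  have h4 := mul_le_mul_of_nonneg_right (hlip s hs t ht) (norm_nonneg (t - s))
  rw [pow_two]
  linarith

theorem exists_isLocalParam {q : Rn n → EReal} (hq : ∀ x, q x ≠ ⊥)
    (hlsc : LowerSemicontinuous q) {z : R2n n} (hz : z ∈ proxreg q) :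
    ∃ (r : ℝ) (K : NNReal) (p : Rn n → Rn n), IsLocalParam (gph (subdiff q)) r K p z ∧
      ∃ e : Rn n → ℝ, ∀ᶠ s in 𝓝 (shear r z), HasFDerivAt e (innerSL ℝ (p s)) s := by
  obtain ⟨ε, hε, ρ, hρ, h⟩ := exists_isProxRegularNear hq hz
  have hzs : z.snd ∈ subdiff q z.fst := hz.1
  -- Proximal points move by at most `2δ` and their subgradients by at most `δ + 2 (ρ + 1) δ = (2ρ +
  -- 3) δ`, both below `ε`.
  set δ : ℝ := ε / (2 * ρ + 4) with hδ
  have hδ0 : 0 < δ := by positivity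
  have hδε : (2 * ρ + 4) * δ = ε := by
    rw [hδ]
    field_simp
  set V : Set (Rn n) := Metric.ball (shear (ρ + 1) z) δ with hV
  have hex : ∀ s : Rn n, ∃ x, s ∈ V → ‖x - z.fst‖ ≤ ε ∧ ‖s - (ρ + 1) • x - z.snd‖ ≤ ε ∧
      s - (ρ + 1) • x ∈ subdiff q x := by
    intro s
    by_cases hs : s ∈ V
    · rw [hV, mem_ball_iff_norm, shear_apply] at hs
      obtain ⟨x, hx, hxs⟩ := h.exists_proximal hq hlsc hzs (s := s) (by nlinarith)
      refine ⟨x, fun _ => ⟨by nlinarith, ?_, hxs⟩⟩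
      have h1 : s - (ρ + 1) • x - z.snd =
          (s - (z.snd + (ρ + 1) • z.fst)) - (ρ + 1) • (x - z.fst) := by
        rw [smul_sub]
        abel
      rw [h1]
      refine (_root_.norm_sub_le _ _).trans ?_
      rw [norm_smul, Real.norm_of_nonneg (by positivity : 0 ≤ ρ + 1)]
      nlinarith
    · exact ⟨0, fun hs' => absurd hs' hs⟩
  choose p₀ hp₀ using hex
  have hlip₀ : ∀ s ∈ V, ∀ t ∈ V, ‖p₀ t - p₀ s‖ ≤ ‖t - s‖ := by
    intro s hs t ht
    obtain ⟨h1, h2, h3⟩ := hp₀ s hs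
    obtain ⟨h4, h5, h6⟩ := hp₀ t ht
    simpa using h.norm_sub_le hq h3 h1 h2 h6 h4 h5
  have hL : LipschitzOnWith 1 p₀ V := by
    refine LipschitzOnWith.of_dist_le_mul fun s hs t ht => ?_
    rw [dist_eq_norm, dist_eq_norm, NNReal.coe_one, one_mul]
    exact hlip₀ t ht s hs
  -- The extension makes `p` globally Lipschitz, at the price of a larger constant; only its values
  -- on `V` carry meaning.
  obtain ⟨p, hp, hpp⟩ := hL.extend_finite_dimension
  have hpV : ∀ s ∈ V, ‖p s - z.fst‖ ≤ ε ∧ ‖s - (ρ + 1) • p s - z.snd‖ ≤ ε ∧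
      s - (ρ + 1) • p s ∈ subdiff q (p s) := fun s hs => hpp hs ▸ hp₀ s hs
  have hVn : V ∈ 𝓝 (shear (ρ + 1) z) := Metric.ball_mem_nhds _ hδ0
  refine ⟨ρ + 1, _, p, ⟨hp, ?_, ?_⟩, ?_⟩
  · have hf : Tendsto (fun w : R2n n => ‖w.fst - z.fst‖) (𝓝 z) (𝓝 0) :=
      tendsto_iff_norm_sub_tendsto_zero.1 ((WithLp.fstL 2 ℝ (Rn n) (Rn n)).continuous.tendsto z)
    have hs : Tendsto (fun w : R2n n => ‖w.snd - z.snd‖) (𝓝 z) (𝓝 0) :=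
      tendsto_iff_norm_sub_tendsto_zero.1 ((WithLp.sndL 2 ℝ (Rn n) (Rn n)).continuous.tendsto z)
    filter_upwards [hf.eventually (gt_mem_nhds hε), hs.eventually (gt_mem_nhds hε),
      ((shear (ρ + 1)).continuous.tendsto z).eventually hVn] with w h1 h2 h3 hw
    obtain ⟨h4, h5, h6⟩ := hpV _ h3
    -- `w` and the parametrized point have the same image under the shear, so the monotonicity
    -- estimate makes them coincide.
    have := h.norm_sub_le hq hw h1.le h2.le h6 h4 h5
    rw [sub_add_cancel, shear_apply, sub_self, norm_zero, norm_le_zero_iff, sub_eq_zero] at this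
    exact this
  · filter_upwards [hVn] with s hs
    exact (hpV s hs).2.2
  · obtain ⟨e, he⟩ := h.exists_potential hq Metric.isOpen_ball (fun s hs => (hpV s hs).2.2)
      (fun s hs => (hpV s hs).1) (fun s hs => (hpV s hs).2.1)
      (fun s hs t ht => by rw [← hpp hs, ← hpp ht]; exact hlip₀ s hs t ht)
    exact ⟨e, by filter_upwards [hVn] with s hs using he s hs⟩

/-! ### Smooth points near `proxreg φ` -/

/-- The points of graphical smoothness whose tangent space is Lagrangian. -/
def lagrangianPoints (F : Rn n → Set (Rn n)) : Set (R2n n) :=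
  {z | z ∈ gph F ∧ ∃ L ∈ Z n, IsIsotropic L ∧ (L : Set (R2n n)) = posTangentConeAt (gph F) z}

/-- `B` is the second derivative of the potential `e`. -/
theorem isSymmetric_of_hasFDerivAt {p : Rn n → Rn n} {e : Rn n → ℝ} {s : Rn n}
    (he : ∀ᶠ t in 𝓝 s, HasFDerivAt e (innerSL ℝ (p t)) t) {B : Rn n →L[ℝ] Rn n}
    (hB : HasFDerivAt p B s) : B.toLinearMap.IsSymmetric := by
  intro u v
  have h1 : HasFDerivAt (fun t => innerSL ℝ (p t)) ((innerSL ℝ).comp B) s :=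
    (innerSL ℝ (E := Rn n)).hasFDerivAt.comp s hB
  have h2 := second_derivative_symmetric_of_eventually he h1 u v
  exact h2.trans (real_inner_comm u (B v))

theorem IsLocalParam.isIsotropic {F : Rn n → Set (Rn n)} {r : ℝ} {K : NNReal} {p : Rn n → Rn n}
    {w : R2n n} (h : IsLocalParam (gph F) r K p w) {e : Rn n → ℝ}
    (he : ∀ᶠ s in 𝓝 (shear r w), HasFDerivAt e (innerSL ℝ (p s)) s) (hw : w ∈ gph F)
    {L : Submodule ℝ (R2n n)} (hL : L ∈ Z n)
    (hT : (L : Set (R2n n)) = posTangentConeAt (gph F) w) : IsIsotropic L := by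
  obtain ⟨B, hB⟩ := h.exists_hasFDerivAt hw hL hT
  rw [h.posTangentConeAt_eq hw hB] at hT
  rw [SetLike.coe_injective hT]
  exact isIsotropic_range_graphMap r (isSymmetric_of_hasFDerivAt he hB)

/-- The parametrization at `z` also serves at nearby graph points, so `w` itself need not belong to
`proxreg q`. -/
theorem eventually_isIsotropic {q : Rn n → EReal} (hq : ∀ x, q x ≠ ⊥)
    (hlsc : LowerSemicontinuous q) {z : R2n n} (hz : z ∈ proxreg q) :
    ∀ᶠ w in 𝓝 z, w ∈ gph (subdiff q) → ∀ L ∈ Z n,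
      (L : Set (R2n n)) = posTangentConeAt (gph (subdiff q)) w → IsIsotropic L := by
  obtain ⟨r, K, p, h, e, he⟩ := exists_isLocalParam hq hlsc hz
  filter_upwards [h.eventually,
    ((shear r).continuous.tendsto z).eventually he.eventually_nhds] with w hw hew hwG L hL hT
  exact hw.isIsotropic hew hwG hL hT

theorem proxreg_subset_closure_smoothPoints {q : Rn n → EReal} (hq : ∀ x, q x ≠ ⊥)
    (hlsc : LowerSemicontinuous q) : proxreg q ⊆ closure (smoothPoints (subdiff q)) := by
  intro z hz
  obtain ⟨r, K, p, h, -⟩ := exists_isLocalParam hq hlsc hz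
  rw [mem_closure_iff_frequently]
  have hcont : Continuous fun s => pair (p s) (s - r • p s) :=
    (WithLp.prod_continuous_toLp 2 (Rn n) (Rn n)).comp (h.lipschitz.continuous.prodMk
      (continuous_id.sub (h.lipschitz.continuous.const_smul r)))
  have hlim : Tendsto (fun s => pair (p s) (s - r • p s)) (𝓝 (shear r z)) (𝓝 z) := by
    have := hcont.tendsto (shear r z)
    rwa [h.eq_fst.self_of_nhds hz.1, pair_shear] at this
  refine hlim.frequently (p := fun w => w ∈ smoothPoints (subdiff q)) ?_
  -- Rademacher's theorem: differentiability almost everywhere, hence on a dense set.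
  have hdense : Dense {s | DifferentiableAt ℝ p s} :=
    MeasureTheory.Measure.dense_of_ae (μ := MeasureTheory.volume) h.lipschitz.ae_differentiableAt
  refine ((mem_closure_iff_frequently.1 (hdense (shear r z))).and_eventually
    (h.mem.and (hlim.eventually h.eventually))).mono ?_
  rintro s ⟨hs, hG, hloc⟩
  have hd : HasFDerivAt p (fderiv ℝ p s) (shear r (pair (p s) (s - r • p s))) := by
    rw [shear_pair_sub]
    exact DifferentiableAt.hasFDerivAt hs
  exact ⟨hG, _, range_graphMap_mem_Z r _, (hloc.posTangentConeAt_eq hG hd).symm⟩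

theorem proxreg_subset_closure_lagrangianPoints {q : Rn n → EReal} (hq : ∀ x, q x ≠ ⊥)
    (hlsc : LowerSemicontinuous q) : proxreg q ⊆ closure (lagrangianPoints (subdiff q)) := by
  intro z hz
  have h1 := mem_closure_iff_frequently.1 (proxreg_subset_closure_smoothPoints hq hlsc hz)
  refine mem_closure_iff_frequently.2
    ((h1.and_eventually (eventually_isIsotropic hq hlsc hz)).mono ?_)
  rintro w ⟨⟨hw, L, hL, hT⟩, hiso⟩
  exact ⟨hw, L, hL, hiso hw L hL hT, hT⟩

theorem exists_isIsotropic_mem_SCDeriv {F : Rn n → Set (Rn n)} {z : R2n n}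
    (hz : z ∈ closure (lagrangianPoints F)) : ∃ L ∈ SCDeriv F z, IsIsotropic L := by
  obtain ⟨zs, hzs, hlim⟩ := mem_closure_iff_seq_limit.1 hz
  choose hG T hT hiso hcone using hzs
  obtain ⟨L, hL, j, hj, hdist⟩ := exists_subseq_tendsto_dZ hT
  refine ⟨L, ⟨hL, fun k => zs (j k), fun k => T (j k),
    fun k => ⟨hG _, T (j k), hT _, hcone _⟩, hlim.comp hj.tendsto_atTop,
    fun k => hcone _, hdist⟩, ?_⟩
  exact isIsotropic_of_tendsto_dZ hdist (Eventually.of_forall fun k => hiso _)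

/-- Members of `ZPW n` are their own adjoints. If `M*` is one, then `M = M** = M*`. Nothing about
subdifferentials enters. -/
theorem SCDerivPW_eq_adjointSCDerivPW (F : Rn n → Set (Rn n)) (z : R2n n) :
    SCDerivPW F z = adjointSCDerivPW F z := by
  ext L
  constructor
  · rintro ⟨hL, hPW⟩
    exact ⟨⟨L, hL, ((isIsotropic_of_mem_ZPW hPW).adjointSubspace_eq hL.1).symm⟩, hPW⟩
  · rintro ⟨⟨M, hM, rfl⟩, hPW⟩
    have h1 := (isIsotropic_of_mem_ZPW hPW).adjointSubspace_eq hPW.1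
    rw [adjointSubspace_adjointSubspace hM.1] at h1
    exact ⟨h1 ▸ hM, hPW⟩

theorem SCDeriv_subset_ZPW {q : Rn n → EReal} (hq : ∀ x, q x ≠ ⊥)
    (hlsc : LowerSemicontinuous q) {z : R2n n} (hz : z ∈ proxreg q) :
    SCDeriv (subdiff q) z ⊆ ZPW n := by
  rintro L ⟨hL, zs, T, hzs, hlim, hT, hdist⟩
  refine (isIsotropic_of_tendsto_dZ hdist ?_).mem_ZPW hL
  filter_upwards [hlim.eventually (eventually_isIsotropic hq hlsc hz)] with k hk
  obtain ⟨hG, M, hM, hMT⟩ := hzs k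
  have : T k = M := SetLike.coe_injective ((hT k).trans hMT.symm)
  exact hk hG _ (this ▸ hM) (hT k)

end SCD

theorem mainTheorem5 (n : ℕ) (φ : SCD.Rn n → EReal)
    (hφ_bot : ∀ x, φ x ≠ ⊥) (hφ_lsc : LowerSemicontinuous φ)
    (hφ_dense : SCD.gph (SCD.subdiff φ) ⊆ closure (SCD.proxreg φ)) :
    (∀ z ∈ SCD.proxreg φ,
      (SCD.SCDeriv (SCD.subdiff φ) z).Nonempty ∧
      SCD.SCDeriv (SCD.subdiff φ) z ⊆ SCD.ZPW n) ∧
    (∀ z ∈ SCD.gph (SCD.subdiff φ),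
      SCD.SCDerivPW (SCD.subdiff φ) z = SCD.adjointSCDerivPW (SCD.subdiff φ) z ∧
      (SCD.SCDerivPW (SCD.subdiff φ) z).Nonempty) := by
  have hcl := SCD.proxreg_subset_closure_lagrangianPoints hφ_bot hφ_lsc
  refine ⟨fun z hz => ⟨?_, SCD.SCDeriv_subset_ZPW hφ_bot hφ_lsc hz⟩,
    fun z hz => ⟨SCD.SCDerivPW_eq_adjointSCDerivPW _ z, ?_⟩⟩
  · obtain ⟨L, hL, -⟩ := SCD.exists_isIsotropic_mem_SCDeriv (hcl hz)
    exact ⟨L, hL⟩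
  · obtain ⟨L, hL, hiso⟩ := SCD.exists_isIsotropic_mem_SCDeriv
      (closure_minimal hcl isClosed_closure (hφ_dense hz))
    exact ⟨L, hL, hiso.mem_ZPW hL.1⟩
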